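/- Let $k$ be a commutative ring and $A$ a commutative $k$-algebra. A Hasse–Schmidt derivation of $A$ over $k$ of length $m$, where $m\ge 1$ is an integer or $m=\infty$, is a sequence $D=(D_i)_{0\le i\le m}$ (with $i$ a finite integer) of $k$-linear maps $A\to A$ such that $D_0=\mathrm{Id}_A$ and $D_i(fg)=\sum_{a+b=i}D_a(f)D_b(g)$ for all $f,g\in A$ and all $i$; its component $D_1$ is a $k$-derivation. For an ideal $I$ of $A$, $D$ is called $I$-logarithmic if $D_i(I)\subseteq I$ for all $i$. Let $\mathrm{IDer}_k(A;m)$ be the set of derivations of the form $D_1$ with $D$ a Hasse–Schmidt derivation of $A$ of length $m$, and $\mathrm{IDer}_k(\log I;m)$ the set of those $D_1$ for which $D$ can be chosen $I$-logarithmic. A leap of $A$ is an integer $s>1$ such that $\mathrm{IDer}_k(A;s)\subsetneq \mathrm{IDer}_k(A;s-1)$. If $\delta$ is a $k$-derivation of $A$ with $\delta(I)\subseteq I$, let $\overline\delta$ be the induced derivation of $A/I$. **Proposition 2.13.** Let $k$ be a unique factorization domain of characteristic $p>0$, let $n,q$ be positive integers with $\mathrm{val}_p(n)\ge 1$ and $\mathrm{val}_p(q)\ge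 1$, and put $\tau=\min\{\mathrm{val}_p(n),\mathrm{val}_p(q)\}$, $s=n/p^\tau$, $t=q/p^\tau$, $h=x^n-y^q$ and $H=x^s-y^t$ in $k[x,y]$. Then, for every integer $m\ge 1$ and for $m=\infty$ (with $\infty\cdot p^\tau=\infty$), every $\delta\in\mathrm{IDer}_k(\log\langle H\rangle;m)$ satisfies $\delta(\langle h\rangle)\subseteq\langle h\rangle$, and $$\mathrm{IDer}_k\big(k[x,y]/\langle h\rangle;\,mp^\tau\big)=\big\{\overline\delta \;\big|\; \delta\in\mathrm{IDer}_k(\log\langle H\rangle;m)\big\},$$ where $\overline\delta$ is the derivation of $k[x,y]/\langle h\rangle$ induced by $\delta$. Moreover, the set of leaps of $k[x,y]/\langle h\rangle$ is exactly $$\{\,r p^\tau \mid r \text{ is a leap of } k[x,y]/\langle H\rangle\,\}\cup\{p^\tau\}.$$ -/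

import Mathlib

/-- A Hasse-Schmidt derivation over `k` of length `m` (a natural number or `∞`) of the commutative
`k`-algebra `A`: a sequence `D₀, D₁, …, D_m` of `k`-linear endomorphisms with `D₀ = id` and
`D_i (x y) = ∑_{a + b = i} D_a x * D_b y`.  The sequence is stored with indices in `ℕ`; the entries
beyond the length carry no information and are normalised to `0`. -/
structure HasseSchmidt (k A : Type*) [CommRing k] [CommRing A] [Algebra k A] (m : ℕ∞) where
  comp : ℕ → A →ₗ[k] A
  comp_zero : comp 0 = LinearMap.id
  comp_mul : ∀ i : ℕ, (i : ℕ∞) ≤ m → ∀ x y : A,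
    comp i (x * y) =
      ∑ ab ∈ Finset.HasAntidiagonal.antidiagonal i, comp ab.1 x * comp ab.2 y
  comp_eq_zero : ∀ i : ℕ, m < (i : ℕ∞) → comp i = 0

/-- `D` is `I`-logarithmic: `D_i(I) ⊆ I` for every `i` (up to the length of `D`). -/
def HasseSchmidt.IsLogarithmic {k A : Type*} [CommRing k] [CommRing A] [Algebra k A] {m : ℕ∞}
    (D : HasseSchmidt k A m) (I : Ideal A) : Prop :=
  ∀ i : ℕ, (i : ℕ∞) ≤ m → ∀ f ∈ I, D.comp i f ∈ I

/-- `IDer_k(A; m)`: the `m`-integrable `k`-derivations of `A`, that is, the degree-one components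
of the Hasse-Schmidt derivations of length `m`; meaningful for `m ≥ 1`. -/
def IDer (k A : Type*) [CommRing k] [CommRing A] [Algebra k A] (m : ℕ∞) :
    Set (Derivation k A A) :=
  {δ | ∃ D : HasseSchmidt k A m, ∀ f : A, D.comp 1 f = δ f}

/-- `IDer_k(log I; m)`: the `I`-logarithmically `m`-integrable `k`-derivations of `A`, that is, the
degree-one components of the `I`-logarithmic Hasse-Schmidt derivations of length `m`;
meaningful for `m ≥ 1`. -/
def IDerLog (k : Type*) {A : Type*} [CommRing k] [CommRing A] [Algebra k A] (I : Ideal A)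
    (m : ℕ∞) : Set (Derivation k A A) :=
  {δ | ∃ D : HasseSchmidt k A m, D.IsLogarithmic I ∧ ∀ f : A, D.comp 1 f = δ f}

/-- `Der_k(log I)`: the `I`-logarithmic `k`-derivations of `A`. -/
def DerLog (k : Type*) {A : Type*} [CommRing k] [CommRing A] [Algebra k A] (I : Ideal A) :
    Set (Derivation k A A) :=
  {δ | ∀ f ∈ I, δ f ∈ I}

/-- The derivation `δ̄` of `A ⧸ I` induced by an `I`-logarithmic derivation `δ` of `A`:
`δ̄ (f + I) = δ f + I`. -/
def DerLog.bar {k A : Type*} [CommRing k] [CommRing A] [Algebra k A] {I : Ideal A}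
    (δ : DerLog k I) : Derivation k (A ⧸ I) (A ⧸ I) :=
  Derivation.mk'
    { toFun := QuotientAddGroup.map I.toAddSubgroup I.toAddSubgroup
        (δ : Derivation k A A).toLinearMap.toAddMonoidHom (fun f hf => δ.2 f hf)
      map_add' := fun a b => map_add _ a b
      map_smul' := fun c a => by
        obtain ⟨f, rfl⟩ := Ideal.Quotient.mk_surjective a
        exact congrArg (Ideal.Quotient.mk I) ((δ : Derivation k A A).map_smul c f) }
    (fun a b => by
      obtain ⟨f, rfl⟩ := Ideal.Quotient.mk_surjective a
      obtain ⟨g, rfl⟩ := Ideal.Quotient.mk_surjective b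
      exact congrArg (Ideal.Quotient.mk I) ((δ : Derivation k A A).leibniz f g))

theorem DerLog.bar_mk {k A : Type*} [CommRing k] [CommRing A] [Algebra k A] {I : Ideal A}
    (δ : DerLog k I) (f : A) :
    DerLog.bar δ (Ideal.Quotient.mk I f) =
      Ideal.Quotient.mk I ((δ : Derivation k A A) f) := rfl

/-- The set of leaps of `A` over `k`: the integers `s > 1` for which the inclusion
`IDer_k(A; s) ⊆ IDer_k(A; s - 1)` is proper. -/
def leaps (k A : Type*) [CommRing k] [CommRing A] [Algebra k A] : Set ℕ :=
  {s | 1 < s ∧ IDer k A (s : ℕ∞) ⊂ IDer k A ((s - 1 : ℕ) : ℕ∞)}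

/-- The polynomial `x ^ n - y ^ q` of `k[x, y]`. -/
noncomputable def binomialCurve (k : Type*) [CommRing k] (n q : ℕ) : MvPolynomial (Fin 2) k :=
  MvPolynomial.X 0 ^ n - MvPolynomial.X 1 ^ q

/-- The ideal of `k[x, y]` generated by `x ^ n - y ^ q`. -/
noncomputable def binomialIdeal (k : Type*) [CommRing k] (n q : ℕ) :
    Ideal (MvPolynomial (Fin 2) k) :=
  Ideal.span {binomialCurve k n q}

/-!
Write `P = p ^ τ`, so that `x ^ n - y ^ q = H ^ P` with `H = x ^ s - y ^ t`.

A Hasse-Schmidt derivation `D` of a polynomial ring `A` is the same thing as a `k`-algebra map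
`φ : A → A⟦X⟧`, `f ↦ ∑ D_i(f) X ^ i`, up to truncation; such a map is determined by the images of
the variables, which may be any power series with the variables as constant terms. In particular
every `D` extends to infinite length, and a Hasse-Schmidt derivation of `A ⧸ I` lifts to an
`I`-logarithmic one of `A` whose first component is any prescribed lift of the given first
component. Hence `δ̄` is `m`-integrable on `A ⧸ I` exactly when `δ` is `I`-logarithmically
`m`-integrable (`bar_mem_IDer_iff`), and the leaps of `A ⧸ I` can be read off from the sets
`IDerLog k I m` (`mem_leaps_quotient_iff`).

In characteristic `p` one has `φ(H ^ P) = φ(H) ^ P = ∑ D_i(H) ^ P X ^ (i P)`. As `A` is a unique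
factorization domain, `H ^ P ∣ D_i(H) ^ P` means `H ∣ D_i(H)`, so being logarithmic for `H ^ P` up to
order `j` is being logarithmic for `H` up to order `⌊j / P⌋` (`mem_IDerLog_span_pow_iff`). With
`j = m P` this is the equality of sets of integrable derivations. For `j < P` the condition is empty,
so the leaps for `H ^ P` are `P` times those for `H`, and `P` itself as soon as some derivation does
not preserve `⟨H⟩` (`leaps_quotient_span_pow`); one of the partial derivatives is such a derivation,
because `p` does not divide both `s` and `t`.
-/

/-! ### Hasse-Schmidt derivations and power series -/

namespace HasseSchmidt

open PowerSeries

section General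

variable {k A : Type*} [CommRing k] [CommRing A] [Algebra k A] {m : ℕ∞}

/-- The Hasse-Schmidt derivation of length `m` whose components are the coefficients, up to order
`m`, of an algebra map `φ : A → A⟦X⟧` lifting the identity modulo `X`. -/
noncomputable def ofAlgHom (φ : A →ₐ[k] A⟦X⟧) (h₀ : ∀ f, coeff 0 (φ f) = f) (m : ℕ∞) :
    HasseSchmidt k A m where
  comp i := if (i : ℕ∞) ≤ m then ((coeff i).restrictScalars k).comp φ.toLinearMap else 0
  comp_zero := by
    ext f
    simpa using h₀ f
  comp_mul i hi x y := by
    have h (a : ℕ × ℕ) (ha : a ∈ Finset.HasAntidiagonal.antidiagonal i) : (a.1 : ℕ∞) ≤ m ∧ (a.2 : ℕ∞) ≤ m := by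
      have := Finset.HasAntidiagonal.mem_antidiagonal.mp ha
      exact ⟨le_trans (by exact_mod_cast (by omega)) hi, le_trans (by exact_mod_cast (by omega)) hi⟩
    simp only [if_pos hi, LinearMap.comp_apply, AlgHom.toLinearMap_apply, map_mul,
      LinearMap.restrictScalars_apply, coeff_mul]
    refine Finset.sum_congr rfl fun a ha => ?_
    rw [if_pos (h a ha).1, if_pos (h a ha).2]
    rfl
  comp_eq_zero i hi := if_neg (not_le.mpr hi)

theorem ofAlgHom_comp (φ : A →ₐ[k] A⟦X⟧) (h₀ : ∀ f, coeff 0 (φ f) = f) {i : ℕ}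
    (hi : (i : ℕ∞) ≤ m) (f : A) : (ofAlgHom φ h₀ m).comp i f = coeff i (φ f) := by
  simp [ofAlgHom, hi]

/-- The `k`-linear endomorphism of `A ⧸ I` induced by one of `A` that preserves `I`. -/
def inducedMap {I : Ideal A} (T : A →ₗ[k] A) (hT : ∀ f ∈ I, T f ∈ I) : A ⧸ I →ₗ[k] A ⧸ I where
  toFun := QuotientAddGroup.map I.toAddSubgroup I.toAddSubgroup T.toAddMonoidHom
    (fun f hf => hT f hf)
  map_add' := fun a b => map_add _ a b
  map_smul' := fun c a => by
    obtain ⟨f, rfl⟩ := Ideal.Quotient.mk_surjective a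
    exact congrArg (Ideal.Quotient.mk I) (T.map_smul c f)

theorem inducedMap_mk {I : Ideal A} (T : A →ₗ[k] A) (hT : ∀ f ∈ I, T f ∈ I) (f : A) :
    inducedMap T hT (Ideal.Quotient.mk I f) = Ideal.Quotient.mk I (T f) := rfl

theorem IsLogarithmic.comp_mem {D : HasseSchmidt k A m} {I : Ideal A} (hD : D.IsLogarithmic I)
    (i : ℕ) (f : A) (hf : f ∈ I) : D.comp i f ∈ I := by
  rcases le_or_gt (i : ℕ∞) m with hi | hi
  · exact hD i hi f hf
  · simp [D.comp_eq_zero i hi]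

/-- The Hasse-Schmidt derivation of `A ⧸ I` induced by an `I`-logarithmic one of `A`. -/
def quotient (D : HasseSchmidt k A m) {I : Ideal A} (hD : D.IsLogarithmic I) :
    HasseSchmidt k (A ⧸ I) m where
  comp i := inducedMap (D.comp i) (hD.comp_mem i)
  comp_zero := by
    refine LinearMap.ext fun a => ?_
    obtain ⟨f, rfl⟩ := Ideal.Quotient.mk_surjective a
    rw [inducedMap_mk, D.comp_zero]
    rfl
  comp_mul i hi a b := by
    obtain ⟨f, rfl⟩ := Ideal.Quotient.mk_surjective a
    obtain ⟨g, rfl⟩ := Ideal.Quotient.mk_surjective b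
    simp only [← map_mul (Ideal.Quotient.mk I), inducedMap_mk, D.comp_mul i hi, map_sum]
  comp_eq_zero i hi := by
    refine LinearMap.ext fun a => ?_
    obtain ⟨f, rfl⟩ := Ideal.Quotient.mk_surjective a
    rw [inducedMap_mk, D.comp_eq_zero i hi, LinearMap.zero_apply, LinearMap.zero_apply, map_zero]

theorem quotient_comp_mk (D : HasseSchmidt k A m) {I : Ideal A} (hD : D.IsLogarithmic I)
    (i : ℕ) (f : A) :
    (D.quotient hD).comp i (Ideal.Quotient.mk I f) = Ideal.Quotient.mk I (D.comp i f) := rfl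

theorem comp_one_eq_zero (D : HasseSchmidt k A m) {i : ℕ} (hi : (i : ℕ∞) ≤ m) (h : 0 < i) :
    D.comp i 1 = 0 := by
  induction i using Nat.strong_induction_on with
  | _ i ih =>
  -- By induction only the two extreme terms of `D_i(1 * 1)` survive, so `D_i(1) = 2 D_i(1)`.
  have key := D.comp_mul i hi 1 1
  have hsum : ∑ ab ∈ Finset.HasAntidiagonal.antidiagonal i, D.comp ab.1 1 * D.comp ab.2 1 =
      ∑ ab ∈ {(i, 0), (0, i)}, D.comp ab.1 1 * D.comp ab.2 1 := by
    symm
    refine Finset.sum_subset (fun a ha => ?_) fun a ha ha' => ?_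
    · simp only [Finset.mem_insert, Finset.mem_singleton] at ha
      rcases ha with rfl | rfl <;> simp
    · have h1 := Finset.HasAntidiagonal.mem_antidiagonal.mp ha
      simp only [Finset.mem_insert, Finset.mem_singleton, Prod.ext_iff] at ha'
      rw [ih a.1 (by omega) (le_trans (by exact_mod_cast (by omega)) hi) (by omega), zero_mul]
  rw [hsum, Finset.sum_pair (by simp [h.ne']), D.comp_zero] at key
  simpa using key

theorem comp_algebraMap (D : HasseSchmidt k A m) {i : ℕ} (hi : (i : ℕ∞) ≤ m) (c : k) :
    D.comp i (algebraMap k A c) = if i = 0 then algebraMap k A c else 0 := by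
  split_ifs with h
  · subst h
    simp [D.comp_zero]
  · rw [Algebra.algebraMap_eq_smul_one, map_smul,
      D.comp_one_eq_zero hi (Nat.pos_of_ne_zero h), smul_zero]

/-- The first component of a Hasse-Schmidt derivation of length at least `1`. -/
def toDerivation (D : HasseSchmidt k A m) (hm : 1 ≤ m) : Derivation k A A :=
  Derivation.mk' (D.comp 1) fun a b => by
    rw [D.comp_mul 1 (by exact_mod_cast hm)]
    simp [Finset.Nat.antidiagonal_succ, D.comp_zero, mul_comm b]

end General

section Polynomial

variable {k σ : Type*} [CommRing k] {m : ℕ∞}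

/-- If the coefficients of `φ` lift the components of `E` along `π` on the variables, then they do so
on all polynomials. With `π` the identity, `E` is recovered from a power series map; with `π` a
quotient map, this lifts `E` to the polynomial ring. -/
theorem coeff_algHom_eq_comp {B : Type*} [CommRing B] [Algebra k B] (E : HasseSchmidt k B m)
    (φ : MvPolynomial σ k →ₐ[k] (MvPolynomial σ k)⟦X⟧) (π : MvPolynomial σ k →ₐ[k] B)
    (hφ : ∀ (j : σ) (i : ℕ), (i : ℕ∞) ≤ m →
      π (coeff i (φ (MvPolynomial.X j))) = E.comp i (π (MvPolynomial.X j)))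
    (f : MvPolynomial σ k) (i : ℕ) (hi : (i : ℕ∞) ≤ m) :
    π (coeff i (φ f)) = E.comp i (π f) := by
  have hmul (f g : MvPolynomial σ k)
      (hf : ∀ i : ℕ, (i : ℕ∞) ≤ m → π (coeff i (φ f)) = E.comp i (π f))
      (hg : ∀ i : ℕ, (i : ℕ∞) ≤ m → π (coeff i (φ g)) = E.comp i (π g))
      (i : ℕ) (hi : (i : ℕ∞) ≤ m) : π (coeff i (φ (f * g))) = E.comp i (π (f * g)) := by
    rw [map_mul φ, map_mul π, E.comp_mul i hi, coeff_mul, map_sum]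
    refine Finset.sum_congr rfl fun a ha => ?_
    have := Finset.HasAntidiagonal.mem_antidiagonal.mp ha
    rw [map_mul, hf _ (le_trans (by exact_mod_cast (by omega)) hi),
      hg _ (le_trans (by exact_mod_cast (by omega)) hi)]
  induction f using MvPolynomial.induction_on generalizing i with
  | C c =>
    rw [← MvPolynomial.algebraMap_eq, AlgHom.commutes φ, AlgHom.commutes π,
      E.comp_algebraMap hi, PowerSeries.algebraMap_apply, coeff_C]
    split_ifs <;> simp
  | add f g hf hg => simp only [map_add, hf i hi, hg i hi]
  | mul_X f j hf => exact hmul f _ hf (hφ j) i hi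

/-- Every derivation of a polynomial ring extends to a Hasse-Schmidt derivation of infinite length,
written as a power series map, with arbitrary values of the higher components on the variables. -/
theorem exists_algHom (δ : Derivation k (MvPolynomial σ k) (MvPolynomial σ k))
    (c : σ → ℕ → MvPolynomial σ k) :
    ∃ φ : MvPolynomial σ k →ₐ[k] (MvPolynomial σ k)⟦X⟧,
      (∀ f, coeff 0 (φ f) = f) ∧ (∀ f, coeff 1 (φ f) = δ f) ∧
      ∀ j i, 2 ≤ i → coeff i (φ (MvPolynomial.X j)) = c j i := by
  let u (j : σ) (i : ℕ) : MvPolynomial σ k :=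
    if i = 0 then MvPolynomial.X j else if i = 1 then δ (MvPolynomial.X j) else c j i
  let φ : MvPolynomial σ k →ₐ[k] (MvPolynomial σ k)⟦X⟧ :=
    MvPolynomial.aeval fun j => PowerSeries.mk (u j)
  have hX (j : σ) (i : ℕ) : coeff i (φ (MvPolynomial.X j)) = u j i := by simp [φ]
  have h₀ (f : MvPolynomial σ k) : coeff 0 (φ f) = f := by
    induction f using MvPolynomial.induction_on with
    | C c =>
      rw [← MvPolynomial.algebraMap_eq, AlgHom.commutes φ, PowerSeries.algebraMap_apply]
      simp
    | add f g hf hg => rw [map_add, map_add, hf, hg]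
    | mul_X f j hf => simp [map_mul, coeff_mul, hf, hX, u]
  refine ⟨φ, h₀, fun f => ?_, fun j i hi => ?_⟩
  -- The first coefficient of `φ` is a derivation, so it suffices to compare it with `δ` on variables.
  · have h : (ofAlgHom φ h₀ 1).toDerivation le_rfl = δ :=
      MvPolynomial.derivation_ext fun j =>
        (ofAlgHom_comp φ h₀ (by simp) _).trans ((hX j 1).trans (by simp [u]))
    rw [← h]
    exact (ofAlgHom_comp φ h₀ (by simp) f).symm
  · rw [hX]
    simp [u, show i ≠ 0 by omega, show i ≠ 1 by omega]

end Polynomial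

end HasseSchmidt

/-! ### Logarithmic integrability and integrability on the quotient -/

open PowerSeries

section Lifting

variable {k σ : Type*} [CommRing k] {m : ℕ∞}

theorem IDerLog_subset_DerLog {A : Type*} [CommRing A] [Algebra k A] (I : Ideal A) (hm : 1 ≤ m) :
    IDerLog k I m ⊆ DerLog k I := by
  rintro δ ⟨D, hD, hδ⟩ f hf
  rw [← hδ]
  exact hD 1 (by exact_mod_cast hm) f hf

/-- Logarithmic integrability along a principal ideal, in terms of power series maps; it suffices to
test the generator of the ideal. -/
theorem mem_IDerLog_span_singleton (hm : 1 ≤ m) (h : MvPolynomial σ k)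
    (δ : Derivation k (MvPolynomial σ k) (MvPolynomial σ k)) :
    δ ∈ IDerLog k (Ideal.span {h}) m ↔
      ∃ φ : MvPolynomial σ k →ₐ[k] (MvPolynomial σ k)⟦X⟧,
        (∀ f, coeff 0 (φ f) = f) ∧ (∀ f, coeff 1 (φ f) = δ f) ∧
        ∀ i : ℕ, (i : ℕ∞) ≤ m → h ∣ coeff i (φ h) := by
  have hm' : ((1 : ℕ) : ℕ∞) ≤ m := by exact_mod_cast hm
  constructor
  · rintro ⟨D, hD, hδ⟩
    have key := D.coeff_algHom_eq_comp
      (MvPolynomial.aeval fun j => PowerSeries.mk fun i => D.comp i (MvPolynomial.X j))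
      (AlgHom.id k _) (by simp)
    refine ⟨MvPolynomial.aeval fun j => PowerSeries.mk fun i => D.comp i (MvPolynomial.X j),
      fun f => ?_, fun f => ?_, fun i hi => ?_⟩
    · exact (key f 0 (by simp)).trans (by simp [D.comp_zero])
    · exact (key f 1 hm').trans (hδ f)
    · rw [← Ideal.mem_span_singleton]
      have := hD i hi h (Ideal.mem_span_singleton_self h)
      rwa [← AlgHom.id_apply (R := k) h, ← key h i hi] at this
  · rintro ⟨φ, h₀, h₁, hh⟩
    refine ⟨.ofAlgHom φ h₀ m, fun i hi f hf => ?_, fun f => ?_⟩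
    · rw [HasseSchmidt.ofAlgHom_comp φ h₀ hi]
      obtain ⟨g, rfl⟩ := Ideal.mem_span_singleton.mp hf
      rw [map_mul, coeff_mul, Ideal.mem_span_singleton]
      refine Finset.dvd_sum fun a ha => Dvd.dvd.mul_right (hh _ (le_trans ?_ hi)) _
      have := Finset.HasAntidiagonal.mem_antidiagonal.mp ha
      exact_mod_cast (by omega)
    · rw [HasseSchmidt.ofAlgHom_comp φ h₀ hm', h₁]

/-- The derivation induced on `k[x] ⧸ I` by an `I`-logarithmic `δ` is `m`-integrable if and only if
`δ` is `I`-logarithmically `m`-integrable: an integral of `δ̄` lifts to one of `δ`. -/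
theorem bar_mem_IDer_iff (hm : 1 ≤ m) {I : Ideal (MvPolynomial σ k)} (δ : DerLog k I) :
    DerLog.bar δ ∈ IDer k (MvPolynomial σ k ⧸ I) m ↔
      (δ : Derivation k (MvPolynomial σ k) (MvPolynomial σ k)) ∈ IDerLog k I m := by
  have hm' : ((1 : ℕ) : ℕ∞) ≤ m := by exact_mod_cast hm
  constructor
  · rintro ⟨E, hE⟩
    -- Lift the first component by `δ` itself and the higher ones arbitrarily.
    obtain ⟨φ, h₀, h₁, h₂⟩ := HasseSchmidt.exists_algHom (δ : Derivation k _ _)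
      fun j i => (E.comp i (Ideal.Quotient.mk I (MvPolynomial.X j))).out
    have key := E.coeff_algHom_eq_comp φ (Ideal.Quotient.mkₐ k I) fun j i _ => by
      rcases i with _ | _ | i
      · rw [h₀, E.comp_zero]; rfl
      · rw [h₁]; exact (hE (Ideal.Quotient.mk I (MvPolynomial.X j))).symm
      · rw [h₂ j _ (by omega)]
        exact Ideal.Quotient.mk_out _
    refine ⟨.ofAlgHom φ h₀ m, fun i hi f hf => ?_, fun f => ?_⟩
    · have hfi := key f i hi
      rw [Ideal.Quotient.mkₐ_eq_mk, Ideal.Quotient.eq_zero_iff_mem.mpr hf, map_zero] at hfi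
      rw [HasseSchmidt.ofAlgHom_comp φ h₀ hi]
      exact Ideal.Quotient.eq_zero_iff_mem.mp hfi
    · rw [HasseSchmidt.ofAlgHom_comp φ h₀ hm', h₁]
  · rintro ⟨D, hD, hδ⟩
    refine ⟨D.quotient hD, fun a => ?_⟩
    obtain ⟨f, rfl⟩ := Ideal.Quotient.mk_surjective a
    rw [D.quotient_comp_mk hD, hδ, DerLog.bar_mk]

theorem bar_surjective (I : Ideal (MvPolynomial σ k)) :
    Function.Surjective (DerLog.bar : DerLog k I → _) := by
  intro d
  let δ : Derivation k (MvPolynomial σ k) (MvPolynomial σ k) :=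
    MvPolynomial.mkDerivation k fun j => (d (Ideal.Quotient.mk I (MvPolynomial.X j))).out
  have h : ((I.mkQ).compDer δ : Derivation k (MvPolynomial σ k) (MvPolynomial σ k ⧸ I)) =
      d.compAlgebraMap (MvPolynomial σ k) :=
    MvPolynomial.derivation_ext fun j => by
      change Ideal.Quotient.mk I (δ (MvPolynomial.X j)) = d (Ideal.Quotient.mk I _)
      simp [δ, Ideal.Quotient.mk_out]
  have h' (f : MvPolynomial σ k) : Ideal.Quotient.mk I (δ f) = d (Ideal.Quotient.mk I f) :=
    DFunLike.congr_fun h f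
  refine ⟨⟨δ, fun f hf => ?_⟩, ?_⟩
  · rw [← Ideal.Quotient.eq_zero_iff_mem, h', Ideal.Quotient.eq_zero_iff_mem.mpr hf, map_zero]
  · ext a
    obtain ⟨f, rfl⟩ := Ideal.Quotient.mk_surjective a
    rw [DerLog.bar_mk, h']

theorem IDer_quotient_subset_iff {a b : ℕ∞} (ha : 1 ≤ a) (hb : 1 ≤ b)
    (I : Ideal (MvPolynomial σ k)) :
    IDer k (MvPolynomial σ k ⧸ I) a ⊆ IDer k (MvPolynomial σ k ⧸ I) b ↔
      IDerLog k I a ⊆ IDerLog k I b := by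
  constructor
  · intro h δ hδ
    have := IDerLog_subset_DerLog I ha hδ
    exact (bar_mem_IDer_iff hb ⟨δ, this⟩).mp (h ((bar_mem_IDer_iff ha ⟨δ, this⟩).mpr hδ))
  · intro h d hd
    obtain ⟨δ, rfl⟩ := bar_surjective I d
    exact (bar_mem_IDer_iff hb δ).mpr (h ((bar_mem_IDer_iff ha δ).mp hd))

theorem mem_leaps_quotient_iff (I : Ideal (MvPolynomial σ k)) (r : ℕ) :
    r ∈ leaps k (MvPolynomial σ k ⧸ I) ↔
      1 < r ∧ IDerLog k I (r : ℕ∞) ⊂ IDerLog k I ((r - 1 : ℕ) : ℕ∞) := by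
  refine and_congr_right fun hr => ?_
  have h₁ : (1 : ℕ∞) ≤ (r : ℕ∞) := by exact_mod_cast hr.le
  have h₂ : (1 : ℕ∞) ≤ ((r - 1 : ℕ) : ℕ∞) := by exact_mod_cast (by omega)
  rw [ssubset_iff_subset_not_subset, ssubset_iff_subset_not_subset,
    IDer_quotient_subset_iff h₁ h₂, IDer_quotient_subset_iff h₂ h₁]

end Lifting

/-! ### Ideals generated by a `p ^ τ`-th power -/

section FrobeniusPower

theorem coeff_pow_char_pow {R : Type*} [CommRing R] (p : ℕ) [hp : Fact p.Prime] [CharP R p]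
    (τ : ℕ) (F : R⟦X⟧) (i : ℕ) :
    coeff i (F ^ p ^ τ) = if p ^ τ ∣ i then coeff (i / p ^ τ) F ^ p ^ τ else 0 := by
  have h : PowerSeries.map (iterateFrobenius R p τ)
      (PowerSeries.expand (p ^ τ) (pow_ne_zero τ hp.out.ne_zero) F) = F ^ p ^ τ :=
    MvPowerSeries.map_iterateFrobenius_expand p hp.out.ne_zero F τ
  rw [← h, coeff_map, coeff_expand]
  split_ifs
  · rw [iterateFrobenius_def]
  · exact map_zero _

variable {k σ : Type*} [CommRing k] [UniqueFactorizationMonoid k]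
  (p : ℕ) [hp : Fact p.Prime] [CharP k p] (τ : ℕ) (H : MvPolynomial σ k)

/-- Being logarithmic for `H ^ p ^ τ` up to order `j` only constrains the components `D_i(H)` with
`i * p ^ τ ≤ j`, and requires them to be divisible by `H`. -/
theorem mem_IDerLog_span_pow_iff {j : ℕ∞} (hj : 1 ≤ j)
    (δ : Derivation k (MvPolynomial σ k) (MvPolynomial σ k)) :
    δ ∈ IDerLog k (Ideal.span {H ^ p ^ τ}) j ↔
      ∃ φ : MvPolynomial σ k →ₐ[k] (MvPolynomial σ k)⟦X⟧,
        (∀ f, coeff 0 (φ f) = f) ∧ (∀ f, coeff 1 (φ f) = δ f) ∧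
        ∀ i : ℕ, ((i * p ^ τ : ℕ) : ℕ∞) ≤ j → H ∣ coeff i (φ H) := by
  have hP : 0 < p ^ τ := pow_pos hp.out.pos τ
  rw [mem_IDerLog_span_singleton hj]
  refine exists_congr fun φ => and_congr_right fun _ => and_congr_right fun _ => ?_
  simp only [map_pow φ, coeff_pow_char_pow p τ]
  constructor
  · intro h i hi
    have := h _ hi
    rw [if_pos (Dvd.intro_left i rfl), Nat.mul_div_cancel _ hP] at this
    exact (UniqueFactorizationMonoid.pow_dvd_pow_iff_dvd hP.ne').mp this
  · intro h i hi
    split_ifs with hd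
    · exact pow_dvd_pow_of_dvd (h _ (by rwa [Nat.div_mul_cancel hd])) _
    · exact dvd_zero _

theorem IDerLog_span_pow_mul {m : ℕ∞} (hm : 1 ≤ m) :
    IDerLog k (Ideal.span {H ^ p ^ τ}) (m * ((p ^ τ : ℕ) : ℕ∞)) =
      IDerLog k (Ideal.span {H}) m := by
  have hP : 0 < p ^ τ := pow_pos hp.out.pos τ
  have hP' : (1 : ℕ∞) ≤ ((p ^ τ : ℕ) : ℕ∞) := by exact_mod_cast hP
  ext δ
  rw [mem_IDerLog_span_pow_iff p τ H (one_le_mul hm hP'), mem_IDerLog_span_singleton hm]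
  simp only [Nat.cast_mul, ENat.mul_le_mul_right_iff (Nat.cast_ne_zero.mpr hP.ne')
    (ENat.natCast_ne_top _)]

theorem IDerLog_span_pow_of_le {j : ℕ} (hj : p ^ τ ≤ j) :
    IDerLog k (Ideal.span {H ^ p ^ τ}) (j : ℕ∞) =
      IDerLog k (Ideal.span {H}) ((j / p ^ τ : ℕ) : ℕ∞) := by
  have hP : 0 < p ^ τ := pow_pos hp.out.pos τ
  ext δ
  rw [mem_IDerLog_span_pow_iff p τ H (by exact_mod_cast hP.trans_le hj),
    mem_IDerLog_span_singleton (by exact_mod_cast Nat.div_pos hj hP)]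
  simp only [Nat.cast_le, Nat.le_div_iff_mul_le hP]

/-- Below order `p ^ τ` only `D_0(H) = H` is constrained, so every derivation is logarithmically
integrable. -/
theorem IDerLog_span_pow_of_lt {j : ℕ} (hj₀ : 0 < j) (hj : j < p ^ τ) :
    IDerLog k (Ideal.span {H ^ p ^ τ}) (j : ℕ∞) = Set.univ := by
  refine Set.eq_univ_of_forall fun δ => ?_
  rw [mem_IDerLog_span_pow_iff p τ H (by exact_mod_cast hj₀)]
  obtain ⟨φ, h₀, h₁, -⟩ := HasseSchmidt.exists_algHom δ 0
  refine ⟨φ, h₀, h₁, fun i hi => ?_⟩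
  have hi' : i * p ^ τ ≤ j := by exact_mod_cast hi
  have : i = 0 := by
    by_contra h
    exact absurd (hi'.trans_lt hj) (not_lt.mpr (Nat.le_mul_of_pos_left _ (by omega)))
  rw [this, h₀]

/-- The leaps for `H ^ p ^ τ` are the multiples by `p ^ τ` of the leaps for `H`, together with `p ^ τ`
when some derivation does not preserve `⟨H⟩`. -/
theorem leaps_quotient_span_pow (hτ : 0 < τ)
    (hH : ∃ δ : Derivation k (MvPolynomial σ k) (MvPolynomial σ k),
      δ ∉ DerLog k (Ideal.span {H})) :
    leaps k (MvPolynomial σ k ⧸ Ideal.span {H ^ p ^ τ}) =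
      {a | ∃ r ∈ leaps k (MvPolynomial σ k ⧸ Ideal.span {H}), a = r * p ^ τ} ∪ {p ^ τ} := by
  have hP : 1 < p ^ τ := Nat.one_lt_pow hτ.ne' hp.out.one_lt
  ext a
  simp only [Set.mem_union, Set.mem_ofPred_eq, Set.mem_singleton_iff, mem_leaps_quotient_iff]
  have hmul {r : ℕ} (hr : 1 < r) :
      IDerLog k (Ideal.span {H ^ p ^ τ}) ((r * p ^ τ : ℕ) : ℕ∞) = IDerLog k (Ideal.span {H}) r ∧
      IDerLog k (Ideal.span {H ^ p ^ τ}) ((r * p ^ τ - 1 : ℕ) : ℕ∞) =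
        IDerLog k (Ideal.span {H}) ((r - 1 : ℕ) : ℕ∞) := by
    have h2 : 2 * p ^ τ ≤ r * p ^ τ := Nat.mul_le_mul_right _ hr
    rw [IDerLog_span_pow_of_le p τ H (by omega), IDerLog_span_pow_of_le p τ H (by omega),
      Nat.mul_div_cancel _ (by omega)]
    refine ⟨rfl, ?_⟩
    rw [Nat.div_eq_of_lt_le (k := r - 1)]
    · rw [Nat.sub_mul]; omega
    · rw [Nat.sub_add_cancel hr.le]; omega
  constructor
  · rintro ⟨ha, hlt⟩
    rcases lt_or_ge a (p ^ τ) with h | h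
    · rw [IDerLog_span_pow_of_lt p τ H (by omega) h,
        IDerLog_span_pow_of_lt p τ H (by omega) (by omega)] at hlt
      exact absurd hlt (ssubset_irrefl _)
    by_cases hd : p ^ τ ∣ a
    · obtain ⟨r, rfl⟩ := hd
      rw [mul_comm] at hlt h ⊢
      rcases lt_trichotomy r 1 with hr | rfl | hr
      · obtain rfl : r = 0 := by omega
        simp at ha
      · exact Or.inr (one_mul _)
      · rw [(hmul hr).1, (hmul hr).2] at hlt
        exact Or.inl ⟨r, ⟨hr, hlt⟩, rfl⟩
    -- If `p ^ τ` does not divide `a`, then `a` and `a - 1` have the same quotient by `p ^ τ`.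
    · have h' : a ≠ p ^ τ := fun h => hd (h ▸ dvd_rfl)
      have hdiv : (a - 1) / p ^ τ = a / p ^ τ := by
        obtain ⟨b, rfl⟩ : ∃ b, a = b + 1 := ⟨a - 1, by omega⟩
        rw [Nat.succ_div_of_not_dvd hd, Nat.add_sub_cancel]
      rw [IDerLog_span_pow_of_le p τ H h, IDerLog_span_pow_of_le p τ H (by omega), hdiv] at hlt
      exact absurd hlt (ssubset_irrefl _)
  · rintro (⟨r, ⟨hr, hlt⟩, rfl⟩ | rfl)
    · rw [(hmul hr).1, (hmul hr).2]
      exact ⟨Nat.one_lt_mul_iff.mpr ⟨by omega, by omega, Or.inl hr⟩, hlt⟩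
    · refine ⟨hP, ?_⟩
      obtain ⟨δ, hδ⟩ := hH
      rw [IDerLog_span_pow_of_le p τ H le_rfl, IDerLog_span_pow_of_lt p τ H (by omega) (by omega),
        Nat.div_self (by omega), Set.ssubset_univ_iff, Set.ne_univ_iff_exists_notMem]
      exact ⟨δ, fun h => hδ (IDerLog_subset_DerLog _ (by simp) h)⟩

end FrobeniusPower

/-! ### Binomial plane curves -/

theorem exists_derivation_notMem_DerLog_binomialIdeal {k : Type*} [CommRing k] {s t : ℕ}
    (hs : 0 < s) (ht : 0 < t) (h : (s : k) ≠ 0 ∨ (t : k) ≠ 0) :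
    ∃ δ : Derivation k (MvPolynomial (Fin 2) k) (MvPolynomial (Fin 2) k),
      δ ∉ DerLog k (binomialIdeal k s t) := by
  -- The point `(1, 1)` lies on the curve, where the partial derivatives of `H` are `s` and `-t`.
  have heval (g : MvPolynomial (Fin 2) k) (hg : g ∈ binomialIdeal k s t) :
      MvPolynomial.eval (fun _ => 1) g = 0 := by
    obtain ⟨c, rfl⟩ := Ideal.mem_span_singleton.mp hg
    simp [binomialCurve]
  have hmem : binomialCurve k s t ∈ binomialIdeal k s t := Ideal.mem_span_singleton_self _
  rcases h with h | h
  · refine ⟨MvPolynomial.pderiv 0, fun hδ => h ?_⟩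
    simpa [binomialCurve, Derivation.leibniz_pow, MvPolynomial.pderiv_X] using heval _ (hδ _ hmem)
  · refine ⟨MvPolynomial.pderiv 1, fun hδ => h ?_⟩
    simpa [binomialCurve, Derivation.leibniz_pow, MvPolynomial.pderiv_X] using heval _ (hδ _ hmem)

theorem proposition2p13 {k : Type*} [CommRing k] [IsDomain k] [UniqueFactorizationMonoid k]
    (p : ℕ) [CharP k p] (hp : 0 < p) (n q τ s t : ℕ)
    (hn : 0 < n) (hq : 0 < q)
    (hα : 1 ≤ padicValNat p n) (hβ : 1 ≤ padicValNat p q)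
    (hτ : τ = min (padicValNat p n) (padicValNat p q))
    (hs : s = n / p ^ τ) (ht : t = q / p ^ τ) :
    (∀ m : ℕ∞, 1 ≤ m →
      IDerLog k (binomialIdeal k s t) m ⊆ DerLog k (binomialIdeal k n q) ∧
      IDer k (MvPolynomial (Fin 2) k ⧸ binomialIdeal k n q) (m * ((p ^ τ : ℕ) : ℕ∞)) =
        {d | ∃ δ : DerLog k (binomialIdeal k n q),
          (δ : Derivation k (MvPolynomial (Fin 2) k) (MvPolynomial (Fin 2) k)) ∈
            IDerLog k (binomialIdeal k s t) m ∧ d = DerLog.bar δ}) ∧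
    leaps k (MvPolynomial (Fin 2) k ⧸ binomialIdeal k n q) =
      {a | ∃ r ∈ leaps k (MvPolynomial (Fin 2) k ⧸ binomialIdeal k s t), a = r * p ^ τ} ∪
        {p ^ τ} := by
  have hpp : Fact p.Prime :=
    ⟨(CharP.char_is_prime_or_zero k p).resolve_right hp.ne'⟩
  have hτ₀ : 0 < τ := by omega
  have hP : 0 < p ^ τ := pow_pos hp τ
  have hsn : s * p ^ τ = n := by
    rw [hs]
    exact Nat.div_mul_cancel ((pow_dvd_pow p (by omega)).trans pow_padicValNat_dvd)
  have htq : t * p ^ τ = q := by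
    rw [ht]
    exact Nat.div_mul_cancel ((pow_dvd_pow p (by omega)).trans pow_padicValNat_dvd)
  have hs₀ : 0 < s := Nat.pos_of_mul_pos_right (hsn ▸ hn)
  have ht₀ : 0 < t := Nat.pos_of_mul_pos_right (htq ▸ hq)
  -- If `p` divided both `s` and `t`, then `p ^ (τ + 1)` would divide both `n` and `q`.
  have hst : (s : k) ≠ 0 ∨ (t : k) ≠ 0 := by
    rw [Ne, Ne, CharP.cast_eq_zero_iff k p, CharP.cast_eq_zero_iff k p]
    by_contra! hdvd
    have key {a b : ℕ} (ha : 0 < b) (hab : a * p ^ τ = b) (hpa : p ∣ a) :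
        τ + 1 ≤ padicValNat p b := by
      rw [← padicValNat_dvd_iff_le ha.ne', pow_succ', ← hab]
      exact mul_dvd_mul_right hpa _
    have h₁ := key hn hsn hdvd.1
    have h₂ := key hq htq hdvd.2
    omega
  have hideal : binomialIdeal k n q = Ideal.span {binomialCurve k s t ^ p ^ τ} := by
    rw [binomialIdeal, binomialCurve, binomialCurve, sub_pow_char_pow, ← pow_mul, ← pow_mul,
      hsn, htq]
  rw [hideal]
  refine ⟨fun m hm => ?_, leaps_quotient_span_pow p τ _ hτ₀
    (exists_derivation_notMem_DerLog_binomialIdeal hs₀ ht₀ hst)⟩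
  have hmP : 1 ≤ m * ((p ^ τ : ℕ) : ℕ∞) := one_le_mul hm (by exact_mod_cast hP)
  have hlog : IDerLog k (binomialIdeal k s t) m =
      IDerLog k (Ideal.span {binomialCurve k s t ^ p ^ τ}) (m * ((p ^ τ : ℕ) : ℕ∞)) :=
    (IDerLog_span_pow_mul p τ _ hm).symm
  rw [hlog]
  refine ⟨IDerLog_subset_DerLog _ hmP, ?_⟩
  ext d
  constructor
  · intro hd
    obtain ⟨δ, rfl⟩ := bar_surjective _ d
    exact ⟨δ, (bar_mem_IDer_iff hmP δ).mp hd, rfl⟩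
  · rintro ⟨δ, hδ, rfl⟩
    exact (bar_mem_IDer_iff hmP δ).mpr hδ
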